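/- **Conventions.** Let $r\in\{0,1,2,\dots,\infty\}$. A parametrization of a set $X$ is a map $\alpha:U\to X$ defined on an open subset $U$ of some $\mathbb{R}^n$, $n\ge 0$. A $C^r$-diffeology on $X$ is a family of parametrizations of $X$ (its plots) that contains all constant parametrizations, contains every parametrization whose restrictions to the members of some open cover of its domain belong to the family, and is stable under composition $\alpha\circ h$ with $C^r$ maps $h:V\to U$, $V\subseteq\mathbb{R}^m$ open. Every set of parametrizations generates a smallest $C^r$-diffeology containing it; in particular a $C^\infty$-diffeology generates a $C^0$-diffeology. A $C^r$-diffeological isomorphism is a bijection such that it and its inverse send plots of the $C^r$-diffeologies to plots. For a connected (finite-dimensional real) Lie group $G$ and a dense countable subgroup $\Gamma\subseteq G$, the set $G/\Gamma$ of left cosets $g\Gamma$, with projection $\pi:G\to G/\Gamma$, carries the quotient $C^\infty$-diffeology, generated by the parametrizations $\pi\circ\alpha$ with $\alpha:U\to G$ of class $C^\infty$; it is called a strongly homogeneous diffeological space. Its $C^0$-diffeology is the one generated by its $C^\infty$-diffeology. **Lemma.** Let $G/\Gamma$ and $G'/\Gamma'$ be two strongly homogeneous diffeological spaces, and let $\varphi:G/\Gamma\to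 G'/\Gamma'$ be a $C^0$-diffeological isomorphism. Then $\varphi$ is a $C^\infty$-diffeological isomorphism. If moreover $G$ and $G'$ are simply connected, then $G$ and $G'$ are isomorphic as Lie groups. -/

import Mathlib

open scoped Manifold ContDiff Topology

/-- An `n`-parametrization of a set `X`: a map from an open subset of `ℝⁿ` to `X`
(together with the dimension `n` and the domain). -/
structure Parametrization (X : Type*) where
  dim : ℕ
  domain : TopologicalSpace.Opens (EuclideanSpace ℝ (Fin dim))
  toFun : domain → X

namespace Parametrization

variable {X Y : Type*}

/-- The constant parametrization with value `x` on the open set `U ⊆ ℝⁿ`. -/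
def const {n : ℕ} (U : TopologicalSpace.Opens (EuclideanSpace ℝ (Fin n))) (x : X) :
    Parametrization X :=
  ⟨n, U, fun _ => x⟩

/-- The restriction of a parametrization to an open subset of its domain. -/
def restrict (p : Parametrization X)
    (V : TopologicalSpace.Opens (EuclideanSpace ℝ (Fin p.dim))) (hV : V ≤ p.domain) :
    Parametrization X :=
  ⟨p.dim, V, fun v => p.toFun ⟨v.1, hV v.2⟩⟩

/-- The composition `α ∘ h` of a parametrization `α : U → X` with a map `h : V → U`, where
`V ⊆ ℝᵐ` is open. The map `h` is given by a map on `ℝᵐ` that sends `V` into `U`; only its values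
on `V` matter. -/
def reparam (p : Parametrization X) {m : ℕ}
    (V : TopologicalSpace.Opens (EuclideanSpace ℝ (Fin m)))
    (h : EuclideanSpace ℝ (Fin m) → EuclideanSpace ℝ (Fin p.dim))
    (hV : ∀ v ∈ V, h v ∈ p.domain) : Parametrization X :=
  ⟨m, V, fun v => p.toFun ⟨h v.1, hV v.1 v.2⟩⟩

/-- The composition `f ∘ α` of a parametrization `α` of `X` with a map `f : X → Y`. -/
def map (f : X → Y) (p : Parametrization X) : Parametrization Y :=
  ⟨p.dim, p.domain, fun u => f (p.toFun u)⟩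

end Parametrization

/-- A diffeology of class `C^r` on `X`, with `r ∈ {0, 1, 2, …, ∞}`. -/
structure CrDiffeology (r : ℕ∞) (X : Type*) where
  /-- The parametrizations belonging to the diffeology. -/
  plots : Set (Parametrization X)
  const_mem : ∀ {n : ℕ} (U : TopologicalSpace.Opens (EuclideanSpace ℝ (Fin n))) (x : X),
    Parametrization.const U x ∈ plots
  locality : ∀ p : Parametrization X,
    (∀ u ∈ p.domain, ∃ (V : TopologicalSpace.Opens (EuclideanSpace ℝ (Fin p.dim)))
      (hV : V ≤ p.domain), u ∈ V ∧ p.restrict V hV ∈ plots) → p ∈ plots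
  reparam_mem : ∀ p ∈ plots, ∀ {m : ℕ}
    (V : TopologicalSpace.Opens (EuclideanSpace ℝ (Fin m)))
    (h : EuclideanSpace ℝ (Fin m) → EuclideanSpace ℝ (Fin p.dim))
    (hV : ∀ v ∈ V, h v ∈ p.domain), ContDiffOn ℝ r h V → p.reparam V h hV ∈ plots

namespace CrDiffeology

variable {r : ℕ∞} {X Y : Type*}

/-- The `C^r`-diffeology generated by a set of parametrizations: its plots are those which
belong to every `C^r`-diffeology containing the given set. -/
def generateFrom (r : ℕ∞) (S : Set (Parametrization X)) : CrDiffeology r X where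
  plots := {p | ∀ D : CrDiffeology r X, S ⊆ D.plots → p ∈ D.plots}
  const_mem U x D _ := D.const_mem U x
  locality p hp D hD := D.locality p fun u hu => by
    obtain ⟨V, hV, huV, h⟩ := hp u hu
    exact ⟨V, hV, huV, h D hD⟩
  reparam_mem p hp _ V h hV hh D hD := D.reparam_mem p (hp D hD) V h hV hh

/-- The direct image of a diffeology `D` on `X` by a map `f : X → Y`: the diffeology on `Y`
generated by the parametrizations `f ∘ α` with `α ∈ D`. -/
def directImage (f : X → Y) (D : CrDiffeology r X) : CrDiffeology r Y :=
  generateFrom r (Parametrization.map f '' D.plots)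

/-- The diffeology of class `C^s` generated by a diffeology of class `C^r` (used for `s ≤ r`). -/
def toClass (s : ℕ∞) (D : CrDiffeology r X) : CrDiffeology s X :=
  generateFrom s D.plots

/-- A diffeological map of class `C^r` sends plots to plots. -/
def IsDiffeologicalMap (D : CrDiffeology r X) (D' : CrDiffeology r Y) (f : X → Y) : Prop :=
  ∀ p ∈ D.plots, p.map f ∈ D'.plots

/-- A diffeological isomorphism of class `C^r`: a bijection which is, together with its inverse,
a diffeological map of class `C^r`. -/
def IsDiffeologicalIso (D : CrDiffeology r X) (D' : CrDiffeology r Y) (φ : X ≃ Y) : Prop :=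
  IsDiffeologicalMap D D' φ ∧ IsDiffeologicalMap D' D φ.symm

/-- The manifold diffeology of class `C^r`: the plots are all the `C^r` maps from open subsets of
Euclidean spaces to the manifold `M`. -/
def manifold (r : ℕ∞) {E H : Type*} [NormedAddCommGroup E] [NormedSpace ℝ E]
    [TopologicalSpace H] (I : ModelWithCorners ℝ E H)
    (M : Type*) [TopologicalSpace M] [ChartedSpace H M] : CrDiffeology r M where
  plots := {p | ContMDiff (𝓡 p.dim) I r p.toFun}
  const_mem _ _ := contMDiff_const
  locality p hp := by
    rintro ⟨u, hu⟩
    obtain ⟨V, hV, huV, h⟩ := hp u hu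
    have h1 : ContMDiffAt (𝓡 p.dim) I r
        (p.toFun ∘ TopologicalSpace.Opens.inclusion hV) ⟨u, huV⟩ := h ⟨u, huV⟩
    exact ((contDiffWithinAt_localInvariantProp (I := 𝓡 p.dim) (I' := I)
      (r : ℕ∞ω)).liftPropAt_iff_comp_inclusion hV p.toFun ⟨u, huV⟩).2 h1
  reparam_mem p hp m V h hV hh := by
    have h1 : ContMDiff (𝓡 m) (𝓡 p.dim) r
        (fun v : V => (⟨h v.1, hV v.1 v.2⟩ : p.domain)) := by
      intro v
      have h2 : ContMDiffAt (𝓡 m) (𝓡 p.dim) r h v.1 :=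
        (hh.contDiffAt (V.isOpen.mem_nhds v.2)).contMDiffAt
      have h3 : ContMDiffAt (𝓡 m) (𝓡 p.dim) r (fun v : V => h v.1) v :=
        contMDiffAt_subtype_iff.2 h2
      exact (ChartedSpace.liftPropWithinAt_subtypeVal_comp_iff (U := p.domain)
        (fun v : V => (⟨h v.1, hV v.1 v.2⟩ : p.domain)) _ _).1 h3
    have hp' : ContMDiff (𝓡 p.dim) I r p.toFun := hp
    exact hp'.comp h1

/-- The smooth quotient diffeology on the space `G ⧸ Γ` of left cosets `gΓ` of a subgroup `Γ` of
a Lie group `G`: the direct image of the manifold diffeology of `G` by the projection. -/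
def quotient {E H : Type*} [NormedAddCommGroup E] [NormedSpace ℝ E]
    [TopologicalSpace H] (I : ModelWithCorners ℝ E H)
    {G : Type*} [TopologicalSpace G] [ChartedSpace H G] [Group G] (Γ : Subgroup G) :
    CrDiffeology ⊤ (G ⧸ Γ) :=
  directImage (QuotientGroup.mk : G → G ⧸ Γ) (manifold ⊤ I G)

end CrDiffeology

/-!
The idea is that a `C^0`-isomorphism `φ : G ⧸ Γ → G' ⧸ Γ'` is covered by continuous local
homomorphisms `G → G'`, and that these are automatically smooth.

The projection to `G ⧸ Γ` of a chart of `G` is a plot, and the `C^0`-plots of `G' ⧸ Γ'` lift locally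
to continuous maps into `G'`. So near each point of `G` there is a continuous `F` with
`F g Γ' = φ (g Γ)` (`CrDiffeology.IsDiffeologicalMap.exists_isCosetLiftOn`). Two such lifts over a
connected set differ by a continuous function with values in the countable set `Γ'`, hence by a
constant. For `γ ∈ Γ` the maps `F` and `g ↦ F (g * γ)` are both lifts, so
`F (g₀ * x * y) = F (g₀ * x) * (F g₀)⁻¹ * F (g₀ * y)` when `y ∈ Γ`, and by density of `Γ` for all
small `x`, `y` (`IsCosetLiftOn.map_mul_mul`): up to translations, `F` is a local homomorphism.

A continuous local homomorphism `f` is smooth (`contMDiffAt_one_of_continuousOn_of_map_mul`). This is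
proved by averaging, without the exponential map: read `f` in a chart of `G'` at the identity, with
multiplication `m`, and let `ρ` be a bump function at `1 ∈ G`. By invariance of Haar measure
`∫ ρ (x⁻¹ * z) • f z = ∫ ρ y • m (f x, f y)`. The left side is smooth in `x`. The right side is
`M (f x)` with `M u = ∫ ρ y • m (u, f y)`; as `m (·, f y)` is close to the identity for small `y`,
the inverse function theorem applies to `M`, and `f` is its local inverse applied to a smooth map.
Hence `φ` has local smooth lifts, and so has its inverse; this is the first claim.

If `G` is simply connected, the local lifts are the sheets of a covering of `G` with discrete fibre
`Γ'` (`IsCosetLiftOn.bundleCore`), which has a section; this gives a global lift, that is, a smooth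
homomorphism `Ψ : G → G'` which covers `φ` up to a translation. Let `Θ : G' → G` be obtained in the
same way from the inverse of `φ`. The composite `Θ ∘ Ψ` covers the identity of `G ⧸ Γ` up to a
translation, so it is an inner automorphism (`exists_eq_conj_of_mk_eq`), and so is `Ψ ∘ Θ`.
Therefore `Ψ` is an isomorphism of Lie groups.
-/

/-! ### Maps into countable sets and lifts of maps between coset spaces -/

/-- A continuous map from a preconnected set to a countable set is constant: a countable completely
regular Hausdorff space is totally disconnected. -/
theorem IsPreconnected.eq_of_mapsTo_countable {X Y : Type*} [TopologicalSpace X]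
    [TopologicalSpace Y] [T35Space Y] {S : Set X} (hS : IsPreconnected S) {C : Set Y}
    (hC : C.Countable) {u : X → Y} (hu : ContinuousOn u S) (huC : Set.MapsTo u S C)
    {x y : X} (hx : x ∈ S) (hy : y ∈ S) : u x = u y := by
  have := hC.totallySeparatedSpace
  have hC' : IsTotallyDisconnected C :=
    totallyDisconnectedSpace_subtype_iff.1 inferInstance
  exact hC' (u '' S) huC.image_subset (hS.image u hu) (Set.mem_image_of_mem u hx)
    (Set.mem_image_of_mem u hy)

/-- The map `F : G → G'` lifts `φ : G ⧸ Γ → G' ⧸ Γ'` over the set `W ⊆ G`. -/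
def IsCosetLiftOn {G G' : Type*} [Group G] [Group G'] {Γ : Subgroup G} {Γ' : Subgroup G'}
    (φ : G ⧸ Γ → G' ⧸ Γ') (F : G → G') (W : Set G) : Prop :=
  ∀ g ∈ W, (F g : G' ⧸ Γ') = φ g

namespace IsCosetLiftOn

variable {G G' : Type*} [Group G] [Group G'] {Γ : Subgroup G} {Γ' : Subgroup G'}
  {φ : G ⧸ Γ → G' ⧸ Γ'} {F F₁ F₂ : G → G'} {W : Set G}

theorem mono (h : IsCosetLiftOn φ F W) {V : Set G} (hV : V ⊆ W) : IsCosetLiftOn φ F V :=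
  fun g hg => h g (hV hg)

theorem inv_mul_mem (h₁ : IsCosetLiftOn φ F₁ W) {V : Set G} (h₂ : IsCosetLiftOn φ F₂ V) {g : G}
    (hg : g ∈ W) (hg' : g ∈ V) : (F₁ g)⁻¹ * F₂ g ∈ Γ' :=
  QuotientGroup.eq.1 ((h₁ g hg).trans (h₂ g hg').symm)

theorem comp_mul_right (h : IsCosetLiftOn φ F W) {γ : G} (hγ : γ ∈ Γ) :
    IsCosetLiftOn φ (fun g => F (g * γ)) {g | g * γ ∈ W} := by
  intro g hg
  rw [h _ hg]
  congr 1
  exact QuotientGroup.eq.2 (by simpa using Γ.inv_mem hγ)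

variable [TopologicalSpace G] [TopologicalSpace G'] [IsTopologicalGroup G']
  [T2Space G']

/-- Two continuous lifts over a connected set differ by a constant, when `Γ'` is countable. -/
theorem inv_mul_eq [Countable Γ'] (hW : IsPreconnected W)
    (h₁ : IsCosetLiftOn φ F₁ W) (h₂ : IsCosetLiftOn φ F₂ W)
    (c₁ : ContinuousOn F₁ W) (c₂ : ContinuousOn F₂ W) {x y : G} (hx : x ∈ W) (hy : y ∈ W) :
    (F₁ x)⁻¹ * F₂ x = (F₁ y)⁻¹ * F₂ y := by
  let _ := IsTopologicalGroup.rightUniformSpace G'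
  have : T35Space G' := {}
  exact hW.eq_of_mapsTo_countable (C := (Γ' : Set G')) (Set.to_countable _)
    (u := fun g => (F₁ g)⁻¹ * F₂ g) (c₁.inv.mul c₂) (fun g hg => h₁.inv_mul_mem h₂ hg hg) hx hy

/-- A continuous lift is, up to a translation, a local homomorphism. For `y ∈ Γ` this holds because
`g ↦ F (g * y)` is another lift, and `Γ` is dense. -/
theorem map_mul_mul [IsTopologicalGroup G] [Countable Γ'] (hΓ : Dense (Γ : Set G)) {V : Set G}
    (hV : IsPreconnected V) (hVo : IsOpen V) (h1 : 1 ∈ V) {g : G}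
    (hF : IsCosetLiftOn φ F W) (cF : ContinuousOn F W)
    (hW : ∀ x ∈ V, ∀ y ∈ V, g * x * y ∈ W) {x y : G} (hx : x ∈ V) (hy : y ∈ V) :
    F (g * x * y) = F (g * x) * (F g)⁻¹ * F (g * y) := by
  have hW1 : ∀ x ∈ V, g * x ∈ W := fun x hx => by simpa using hW x hx 1 h1
  -- continuity in `y` reduces the identity to `y ∈ Γ`
  have hc1 : ContinuousOn (fun y => F (g * x * y)) V :=
    cF.comp (by fun_prop) fun y hy => hW x hx y hy
  have hc2 : ContinuousOn (fun y => F (g * x) * (F g)⁻¹ * F (g * y)) V :=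
    continuousOn_const.mul (cF.comp (by fun_prop) fun y hy => hW1 y hy)
  have key : Set.EqOn (fun y => F (g * x * y)) (fun y => F (g * x) * (F g)⁻¹ * F (g * y))
      (V ∩ Γ) := by
    rintro γ ⟨hγV, hγ⟩
    have hS : IsPreconnected ((fun x => g * x) '' V) :=
      hV.image _ (by fun_prop)
    have hsub : (fun x => g * x) '' V ⊆ W := by
      rintro _ ⟨x, hx, rfl⟩; exact hW1 x hx
    have hsub' : (fun x => g * x) '' V ⊆ {z | z * γ ∈ W} := by
      rintro _ ⟨x, hx, rfl⟩; exact hW x hx γ hγV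
    have := inv_mul_eq hS (hF.mono hsub) ((hF.comp_mul_right hγ).mono hsub') (cF.mono hsub)
      (cF.comp (by fun_prop) fun z hz => hsub' hz) (Set.mem_image_of_mem _ hx)
      (Set.mem_image_of_mem _ h1)
    simp only [mul_one] at this
    simp only [mul_assoc]
    rw [mul_assoc] at this
    rw [← this, mul_inv_cancel_left]
  exact key.of_subset_closure hc1 hc2 Set.inter_subset_left
    (by simpa using hΓ.open_subset_closure_inter hVo) hy

end IsCosetLiftOn

/-! ### Global lifts over simply connected groups -/

/-- A copy of the group `α` with the discrete topology. -/
def DiscreteCopy (α : Type*) := α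

namespace DiscreteCopy

instance (α : Type*) : TopologicalSpace (DiscreteCopy α) := ⊥

instance (α : Type*) : DiscreteTopology (DiscreteCopy α) := ⟨rfl⟩

instance (α : Type*) [Group α] : Group (DiscreteCopy α) := inferInstanceAs (Group α)

/-- The inclusion of a subgroup with the discrete topology. -/
def subtype {G : Type*} [Group G] (Γ : Subgroup G) : DiscreteCopy Γ →* G := Γ.subtype

theorem subtype_injective {G : Type*} [Group G] (Γ : Subgroup G) :
    Function.Injective (subtype Γ) := Γ.subtype_injective

theorem subtype_mem {G : Type*} [Group G] {Γ : Subgroup G} (γ : DiscreteCopy Γ) :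
    subtype Γ γ ∈ Γ := SetLike.coe_mem (A := Subgroup G) (B := G) (p := Γ) γ

open Classical in
/-- The element `x` of `G` as an element of the discrete group `Γ`; the junk value is `1`
if `x` does not belong to `Γ`. -/
noncomputable def ofGroup {G : Type*} [Group G] (Γ : Subgroup G) (x : G) : DiscreteCopy Γ :=
  (if h : x ∈ Γ then ⟨x, h⟩ else 1 : Γ)

theorem subtype_ofGroup {G : Type*} [Group G] {Γ : Subgroup G} {x : G} (h : x ∈ Γ) :
    subtype Γ (ofGroup Γ x) = x :=
  congrArg Subtype.val (dif_pos h)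

end DiscreteCopy

namespace IsCosetLiftOn

variable {G G' : Type*} [Group G] [Group G'] {Γ : Subgroup G} {Γ' : Subgroup G'}
  {φ : G ⧸ Γ → G' ⧸ Γ'}
  [TopologicalSpace G] [TopologicalSpace G'] [IsTopologicalGroup G']
  [T2Space G']

open DiscreteCopy

/-- The covering of `G` whose sheets are the local lifts of `φ`: given local lifts `F i` over an
open cover `W i`, the point `γ ∈ Γ'` of the fibre over `g` in the chart `i` stands for the
value `F i g * γ`. The fibre carries the discrete topology. -/
noncomputable def bundleCore [Countable Γ'] [LocallyConnectedSpace G] (W : G → Set G)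
    (hWo : ∀ i, IsOpen (W i)) (hW : ∀ i, i ∈ W i) (F : G → G → G')
    (hF : ∀ i, IsCosetLiftOn φ (F i) (W i)) (cF : ∀ i, ContinuousOn (F i) (W i)) :
    FiberBundleCore G G (DiscreteCopy Γ') where
  baseSet := W
  isOpen_baseSet := hWo
  indexAt := id
  mem_baseSet_at := hW
  coordChange i j b γ := ofGroup Γ' ((F j b)⁻¹ * F i b) * γ
  coordChange_self i x hx γ := subtype_injective Γ' <| by
    simp [subtype_ofGroup Γ'.one_mem]
  continuousOn_coordChange i j := by
    -- on a connected neighbourhood of a point the coordinate change does not depend on the point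
    rintro ⟨b, γ⟩ ⟨⟨hi, hj⟩, -⟩
    refine ContinuousAt.continuousWithinAt ?_
    obtain ⟨V, ⟨hVo, hbV, hVc⟩, hV⟩ := (LocallyConnectedSpace.open_connected_basis b).mem_iff.1
      (((hWo i).inter (hWo j)).mem_nhds ⟨hi, hj⟩)
    have hc : ∀ x ∈ V, (F j x)⁻¹ * F i x = (F j b)⁻¹ * F i b := fun x hx =>
      inv_mul_eq hVc.isPreconnected ((hF j).mono fun y hy => (hV hy).2)
        ((hF i).mono fun y hy => (hV hy).1) ((cF j).mono fun y hy => (hV hy).2)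
        ((cF i).mono fun y hy => (hV hy).1) hx hbV
    refine ContinuousAt.congr (f := fun p : G × DiscreteCopy Γ' =>
      ofGroup Γ' ((F j b)⁻¹ * F i b) * p.2) ?_ ?_
    · exact (continuous_of_discreteTopology.comp continuous_snd).continuousAt
    · filter_upwards [prod_mem_nhds (hVo.mem_nhds hbV) Filter.univ_mem] with p hp
      simp only [hc p.1 hp.1]
  coordChange_comp i j k x hx γ := subtype_injective Γ' <| by
    obtain ⟨⟨hi, hj⟩, hk⟩ := hx
    simp only [map_mul, subtype_ofGroup ((hF k).inv_mul_mem (hF j) hk hj),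
      subtype_ofGroup ((hF j).inv_mul_mem (hF i) hj hi),
      subtype_ofGroup ((hF k).inv_mul_mem (hF i) hk hi)]
    group

/-- Local continuous lifts of `φ` on a simply connected group give a global one: the identity
of `G` lifts to the covering of local lifts. -/
theorem exists_global [Countable Γ'] [SimplyConnectedSpace G] [LocallyPathConnectedSpace G]
    (h : ∀ g, ∃ W, IsOpen W ∧ g ∈ W ∧ ∃ F, ContinuousOn F W ∧ IsCosetLiftOn φ F W) :
    ∃ F : G → G', Continuous F ∧ IsCosetLiftOn φ F Set.univ := by
  choose W hWo hW F cF hF using h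
  let Z := bundleCore W hWo hW F hF cF
  have cov : IsCoveringMap (Bundle.TotalSpace.proj : Z.TotalSpace → G) :=
    FiberBundle.isCoveringMap
  obtain ⟨s, ⟨-, hs⟩, -⟩ := cov.existsUnique_continuousMap_lifts (ContinuousMap.id G) 1
    (⟨1, (1 : DiscreteCopy Γ')⟩ : Z.TotalSpace) rfl
  have hs' : ∀ g, (s g).proj = g := fun g => congrFun hs g
  obtain ⟨σ, hσ⟩ : ∃ σ : G → DiscreteCopy Γ', ∀ g, σ g = (s g).snd := ⟨_, fun _ => rfl⟩
  refine ⟨fun g => F g g * subtype Γ' (σ g), ?_, ?_⟩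
  · refine continuous_iff_continuousAt.2 fun g => ?_
    -- in the chart at `g` the section is `F g` times a continuous map to the discrete group
    have c1 : ContinuousAt (fun x => (Z.localTriv g (s x)).2) g := by
      refine continuousAt_snd.comp (ContinuousAt.comp ?_ s.continuous.continuousAt)
      refine (Z.localTriv g).continuousAt ?_
      rw [FiberBundleCore.mem_localTriv_source, hs']
      exact hW g
    have c2 : ContinuousAt (fun x => F g x * subtype Γ' (Z.localTriv g (s x)).2) g :=
      ((cF g).continuousAt ((hWo g).mem_nhds (hW g))).mul
        (continuous_of_discreteTopology.continuousAt.comp c1)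
    refine c2.congr ?_
    filter_upwards [(hWo g).mem_nhds (hW g)] with x hx
    have h2 : (Z.localTriv g (s x)).2 =
        ofGroup Γ' ((F g (s x).proj)⁻¹ * F (s x).proj (s x).proj) * σ x := by
      rw [hσ]; rfl
    simp only [h2, hs', map_mul, subtype_ofGroup ((hF g).inv_mul_mem (hF x) hx (hW x))]
    group
  · intro g _
    dsimp only
    rw [QuotientGroup.mk_mul_of_mem _ (subtype_mem _), hF _ _ (hW _)]

end IsCosetLiftOn

/-! ### Smoothness of parametric integrals over compact sets -/

section ParametricIntegral

open MeasureTheory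

variable {X : Type*} [TopologicalSpace X] [T2Space X] [MeasurableSpace X] [OpensMeasurableSpace X]
  {μ : Measure X} [IsFiniteMeasureOnCompacts μ]
  {E Z F : Type*} [NormedAddCommGroup E] [NormedSpace ℝ E] [FiniteDimensional ℝ E]
  [NormedAddCommGroup Z] [NormedSpace ℝ Z] [NormedAddCommGroup F] [NormedSpace ℝ F]
  {U : Set E} {V : Set Z} {K : Set X} {a : X → Z}

theorem hasFDerivAt_setIntegral_of_contDiffOn (hU : IsOpen U) (hV : IsOpen V) (hK : IsCompact K)
    (ha : ContinuousOn a K) (haV : Set.MapsTo a K V) {L : E × Z → F}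
    (hL : ContDiffOn ℝ ∞ L (U ×ˢ V)) {x₀ : E} (hx₀ : x₀ ∈ U) :
    HasFDerivAt (fun x => ∫ z in K, L (x, a z) ∂μ)
      (∫ z in K, (fderiv ℝ L (x₀, a z)).comp (ContinuousLinearMap.inl ℝ E Z) ∂μ) x₀ := by
  have hUV : IsOpen (U ×ˢ V) := hU.prod hV
  have hpair : ∀ x : E, ContinuousOn (fun z => (x, a z)) K := fun x => continuousOn_const.prodMk ha
  have hmaps : ∀ x ∈ U, Set.MapsTo (fun z => (x, a z)) K (U ×ˢ V) :=
    fun x hx z hz => ⟨hx, haV hz⟩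
  have hdL : ContinuousOn (fun p => (fderiv ℝ L p).comp (ContinuousLinearMap.inl ℝ E Z)) (U ×ˢ V) :=
    (hL.continuousOn_fderiv_of_isOpen hUV (by simp)).clm_comp continuousOn_const
  -- a compact neighbourhood of `x₀` gives a uniform bound for the derivatives
  obtain ⟨B, hB, hBx, hBU⟩ := exists_compact_subset hU hx₀
  have hBK : IsCompact (B ×ˢ (a '' K)) := hB.prod (hK.image_of_continuousOn ha)
  obtain ⟨C, hC⟩ := hBK.exists_bound_of_continuousOn (hdL.mono (by
    rintro ⟨x, w⟩ ⟨hx, z, hz, rfl⟩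
    exact ⟨hBU hx, haV hz⟩))
  refine hasFDerivAt_integral_of_dominated_of_fderiv_le (bound := fun _ => C)
    (F' := fun x z => (fderiv ℝ L (x, a z)).comp (ContinuousLinearMap.inl ℝ E Z))
    (mem_interior_iff_mem_nhds.1 hBx) ?_ ?_ ?_ ?_ ?_ ?_
  · filter_upwards [hU.mem_nhds hx₀] with x hx
    exact (hL.continuousOn.comp (hpair x) (hmaps x hx)).aestronglyMeasurable_of_isCompact hK
      hK.measurableSet
  · exact (hL.continuousOn.comp (hpair x₀) (hmaps x₀ hx₀)).integrableOn_compact hK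
  · exact (hdL.comp (hpair x₀) (hmaps x₀ hx₀)).aestronglyMeasurable_of_isCompact hK
      hK.measurableSet
  · refine (ae_restrict_iff' hK.measurableSet).2 (.of_forall fun z hz x hx => ?_)
    exact hC (x, a z) ⟨hx, Set.mem_image_of_mem a hz⟩
  · exact continuousOn_const.integrableOn_compact hK
  · refine (ae_restrict_iff' hK.measurableSet).2 (.of_forall fun z hz x hx => ?_)
    have h1 : HasFDerivAt L (fderiv ℝ L (x, a z)) (x, a z) :=
      ((hL.contDiffAt (hUV.mem_nhds ⟨hBU hx, haV hz⟩)).differentiableAt (by simp)).hasFDerivAt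
    exact h1.comp x ((hasFDerivAt_id x).prodMk (hasFDerivAt_const (a z) x))

theorem contDiffOn_setIntegral [CompleteSpace F] (hU : IsOpen U) (hV : IsOpen V) (hK : IsCompact K)
    (ha : ContinuousOn a K) (haV : Set.MapsTo a K V) {L : E × Z → F}
    (hL : ContDiffOn ℝ ∞ L (U ×ˢ V)) :
    ContDiffOn ℝ ∞ (fun x => ∫ z in K, L (x, a z) ∂μ) U := by
  refine contDiffOn_infty.2 fun n => ?_
  induction n generalizing L with
  | zero =>
    exact contDiffOn_zero.2 fun x hx => (hasFDerivAt_setIntegral_of_contDiffOn hU hV hK ha haV hL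
      hx).continuousAt.continuousWithinAt
  | succ n ih =>
    rw [Nat.cast_succ]
    refine contDiffOn_succ_of_fderiv_apply (fun x hx => (hasFDerivAt_setIntegral_of_contDiffOn hU
      hV hK ha haV hL hx).differentiableAt.differentiableWithinAt)
      (fun h => absurd h (by simp)) fun y => ?_
    have hL' : ContDiffOn ℝ ∞ (fun p => fderiv ℝ L p (y, 0)) (U ×ˢ V) :=
      (hL.fderiv_of_isOpen (hU.prod hV) (m := ∞) (by simp)).clm_apply contDiffOn_const
    refine (ih hL').congr fun x hx => ?_
    rw [fderivWithin_of_isOpen hU hx,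
      (hasFDerivAt_setIntegral_of_contDiffOn hU hV hK ha haV hL hx).fderiv,
      ContinuousLinearMap.integral_apply]
    · simp
    · refine ContinuousOn.integrableOn_compact hK ?_
      refine ContinuousOn.clm_comp ?_ continuousOn_const
      exact (hL.continuousOn_fderiv_of_isOpen (hU.prod hV) (by simp)).comp
        (continuousOn_const.prodMk ha) fun z hz => ⟨hx, haV hz⟩

end ParametricIntegral

/-! ### Continuous local homomorphisms of Lie groups are smooth -/

section LocalHom

open MeasureTheory

/-- If all the maps `m (·, v y)` have derivative close to the identity at `a`, then so does their
average for the weight `ρ`, up to scaling; hence the average has a smooth local left inverse. -/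
theorem exists_contDiffAt_leftInverse_setIntegral {X : Type*} [TopologicalSpace X] [T2Space X]
    [MeasurableSpace X] [OpensMeasurableSpace X] {μ : Measure X} [IsFiniteMeasureOnCompacts μ]
    {E : Type*} [NormedAddCommGroup E] [NormedSpace ℝ E] [FiniteDimensional ℝ E]
    {K : Set X} (hK : IsCompact K) {ρ : X → ℝ} (hρ : ContinuousOn ρ K) (hρ0 : ∀ y, 0 ≤ ρ y)
    (hρ1 : 0 < ∫ y in K, ρ y ∂μ) {U : Set E} (hU : IsOpen U) {a : E} (ha : a ∈ U)
    {v : X → E} (hv : ContinuousOn v K) (hvU : Set.MapsTo v K U) {m : E × E → E}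
    (hm : ContDiffOn ℝ ∞ m (U ×ˢ U))
    (hmv : ∀ y ∈ K, ‖(fderiv ℝ m (a, v y)).comp (ContinuousLinearMap.inl ℝ E E) -
      ContinuousLinearMap.id ℝ E‖ ≤ 1 / 2) :
    ∃ g : E → E, ContDiffAt ℝ ∞ g (∫ y in K, ρ y • m (a, v y) ∂μ) ∧
      ∀ᶠ u in 𝓝 a, g (∫ y in K, ρ y • m (u, v y) ∂μ) = u := by
  have hUU : IsOpen (U ×ˢ U) := hU.prod hU
  set A : X → E →L[ℝ] E := fun y => (fderiv ℝ m (a, v y)).comp (ContinuousLinearMap.inl ℝ E E)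
    with hA
  have hAc : ContinuousOn A K :=
    ((hm.continuousOn_fderiv_of_isOpen hUU (by simp)).comp (continuousOn_const.prodMk hv)
      fun y hy => ⟨ha, hvU hy⟩).clm_comp continuousOn_const
  have hAi : IntegrableOn (fun y => ρ y • A y) K μ := (hρ.smul hAc).integrableOn_compact hK
  have hIi : IntegrableOn (fun y => ρ y • ContinuousLinearMap.id ℝ E) K μ :=
    (hρ.smul continuousOn_const).integrableOn_compact hK
  -- the weight and the second argument of `m` are the parameters over which `m` is averaged
  set L : E × (ℝ × E) → E := fun p => p.2.1 • m (p.1, p.2.2) with hL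
  have hLs : ContDiffOn ℝ ∞ L (U ×ˢ (Set.univ ×ˢ U)) :=
    contDiffOn_snd.fst.smul (hm.comp (contDiffOn_fst.prodMk contDiffOn_snd.snd)
      fun p hp => ⟨hp.1, hp.2.2⟩)
  have hpar : ContinuousOn (fun y => (ρ y, v y)) K := hρ.prodMk hv
  have hmaps : Set.MapsTo (fun y => (ρ y, v y)) K (Set.univ ×ˢ U) := fun y hy => ⟨trivial, hvU hy⟩
  have hVo : IsOpen ((Set.univ : Set ℝ) ×ˢ U) := isOpen_univ.prod hU
  have hMs := (contDiffOn_setIntegral (μ := μ) hU hVo hK hpar hmaps hLs).contDiffAt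
    (hU.mem_nhds ha)
  have hMd := hasFDerivAt_setIntegral_of_contDiffOn (μ := μ) hU hVo hK hpar hmaps hLs ha
  have hD : ∫ y in K, (fderiv ℝ L (a, (ρ y, v y))).comp (ContinuousLinearMap.inl ℝ E (ℝ × E)) ∂μ =
      ∫ y in K, ρ y • A y ∂μ := by
    refine setIntegral_congr_fun hK.measurableSet fun y hy => ?_
    have h1 : HasFDerivAt L (fderiv ℝ L (a, (ρ y, v y))) (a, (ρ y, v y)) :=
      ((hLs.contDiffAt ((hU.prod hVo).mem_nhds ⟨ha, hmaps hy⟩)).differentiableAt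
        (by simp)).hasFDerivAt
    have h2 : HasFDerivAt m (fderiv ℝ m (a, v y)) (a, v y) :=
      ((hm.contDiffAt (hUU.mem_nhds ⟨ha, hvU hy⟩)).differentiableAt (by simp)).hasFDerivAt
    have h1' := HasFDerivAt.comp (f := fun u : E => (u, (ρ y, v y))) a h1
      (hasFDerivAt_prodMk_left a (ρ y, v y))
    have h2' := (HasFDerivAt.comp (f := fun u : E => (u, v y)) a h2
      (hasFDerivAt_prodMk_left a (v y))).const_smul (ρ y)
    exact h1'.unique h2'
  rw [hD] at hMd
  set T := ∫ y in K, ρ y • A y ∂μ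
  set c := ∫ y in K, ρ y ∂μ with hc
  have hT : ‖T - c • ContinuousLinearMap.id ℝ E‖ ≤ c / 2 := by
    have h1 : T - c • ContinuousLinearMap.id ℝ E =
        ∫ y in K, (ρ y • A y - ρ y • ContinuousLinearMap.id ℝ E) ∂μ := by
      rw [integral_sub hAi hIi, integral_smul_const]
    rw [h1, hc, ← integral_div]
    refine norm_integral_le_of_norm_le ((hρ.div_const 2).integrableOn_compact hK)
      ((ae_restrict_iff' hK.measurableSet).2 (.of_forall fun y hy => ?_))
    rw [← smul_sub, norm_smul, Real.norm_of_nonneg (hρ0 y)]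
    calc ρ y * _ ≤ ρ y * (1 / 2) := mul_le_mul_of_nonneg_left (hmv y hy) (hρ0 y)
      _ = ρ y / 2 := by ring
  have hinj : Function.Injective (T : E →ₗ[ℝ] E) := by
    refine (injective_iff_map_eq_zero _).2 fun h hh => ?_
    have h1 : (T - c • ContinuousLinearMap.id ℝ E) h = -(c • h) := by
      have : T h = 0 := hh
      simp [this]
    have h2 := (T - c • ContinuousLinearMap.id ℝ E).le_of_opNorm_le hT h
    rw [h1, norm_neg, norm_smul, Real.norm_of_nonneg hρ1.le] at h2
    have : ‖h‖ ≤ 0 := by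
      by_contra! h3
      nlinarith [mul_pos hρ1 h3]
    exact norm_le_zero_iff.1 this
  let e : E ≃L[ℝ] E := (LinearEquiv.ofInjectiveEndo (T : E →ₗ[ℝ] E) hinj).toContinuousLinearEquiv
  have he : (e : E →L[ℝ] E) = T := by ext; rfl
  rw [← he] at hMd
  exact ⟨_, hMs.to_localInverse hMd (by simp),
    (hMs.hasStrictFDerivAt' hMd (by simp)).eventually_left_inverse⟩

variable {E : Type*} [NormedAddCommGroup E] [NormedSpace ℝ E]
  {G : Type*} [TopologicalSpace G] [ChartedSpace E G] [Group G]

/-- The multiplication of a Lie group, read in the chart at the identity. -/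
noncomputable def chartMul (E G : Type*) [NormedAddCommGroup E] [NormedSpace ℝ E]
    [TopologicalSpace G] [ChartedSpace E G] [Group G] (p : E × E) : E :=
  extChartAt 𝓘(ℝ, E) (1 : G)
    ((extChartAt 𝓘(ℝ, E) (1 : G)).symm p.1 * (extChartAt 𝓘(ℝ, E) (1 : G)).symm p.2)

theorem chartMul_one_right {u : E} (hu : u ∈ (extChartAt 𝓘(ℝ, E) (1 : G)).target) :
    chartMul E G (u, extChartAt 𝓘(ℝ, E) (1 : G) 1) = u := by
  rw [chartMul, extChartAt_to_inv, mul_one, PartialEquiv.right_inv _ hu]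

variable [LieGroup 𝓘(ℝ, E) ∞ G]

theorem exists_contDiffOn_chartMul : ∃ U : Set E, IsOpen U ∧ extChartAt 𝓘(ℝ, E) (1 : G) 1 ∈ U ∧
    U ⊆ (extChartAt 𝓘(ℝ, E) (1 : G)).target ∧ ContDiffOn ℝ ∞ (chartMul E G) (U ×ˢ U) := by
  have : IsTopologicalGroup G := topologicalGroup_of_lieGroup 𝓘(ℝ, E) ∞
  set c := extChartAt 𝓘(ℝ, E) (1 : G)
  have hto : IsOpen c.target := isOpen_extChartAt_target 1
  have hcs : ContMDiffOn 𝓘(ℝ, E) 𝓘(ℝ, E) ∞ c.symm c.target := contMDiffOn_extChartAt_symm 1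
  have hmul : ContMDiffOn 𝓘(ℝ, E × E) 𝓘(ℝ, E) ∞ (fun p : E × E => c.symm p.1 * c.symm p.2)
      (c.target ×ˢ c.target) :=
    ContMDiffOn.mul (I := 𝓘(ℝ, E))
      (hcs.comp contDiffOn_fst.contMDiffOn fun p hp => hp.1)
      (hcs.comp contDiffOn_snd.contMDiffOn fun p hp => hp.2)
  have hs : IsOpen c.source := isOpen_extChartAt_source 1
  have hN : (fun p : E × E => c.symm p.1 * c.symm p.2) ⁻¹' c.source ∈ 𝓝 (c 1, c 1) := by
    refine (hmul.continuousOn.continuousAt ((hto.prod hto).mem_nhds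
      ⟨mem_extChartAt_target 1, mem_extChartAt_target 1⟩)).preimage_mem_nhds (hs.mem_nhds ?_)
    simp [c]
  obtain ⟨U₁, U₂, hU₁, h₁, hU₂, h₂, hU⟩ := mem_nhds_prod_iff'.1 hN
  refine ⟨U₁ ∩ U₂ ∩ c.target, (hU₁.inter hU₂).inter hto, ⟨⟨h₁, h₂⟩, mem_extChartAt_target 1⟩,
    Set.inter_subset_right, ?_⟩
  rw [← contMDiffOn_iff_contDiffOn]
  have hc : ContMDiffOn 𝓘(ℝ, E) 𝓘(ℝ, E) ∞ c c.source := by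
    simpa [c] using contMDiffOn_extChartAt (I := 𝓘(ℝ, E)) (n := ∞) (x := (1 : G))
  exact hc.comp (hmul.mono fun p hp => ⟨hp.1.2, hp.2.2⟩)
    fun p hp => hU ⟨hp.1.1.1, hp.2.1.2⟩

variable [FiniteDimensional ℝ E]

/-- The average of `v` against left translates of a smooth weight is smooth. -/
theorem contMDiffAt_setIntegral_translate [T2Space G] [MeasurableSpace G] [OpensMeasurableSpace G]
    {μ : Measure G} [IsFiniteMeasureOnCompacts μ]
    {F : Type*} [NormedAddCommGroup F] [NormedSpace ℝ F] [CompleteSpace F]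
    {K : Set G} (hK : IsCompact K) (hKs : K ⊆ (extChartAt 𝓘(ℝ, E) (1 : G)).source)
    {ρ : G → ℝ} (hρ : ContMDiff 𝓘(ℝ, E) 𝓘(ℝ) ∞ ρ) {v : G → F} (hv : ContinuousOn v K) :
    ContMDiffAt 𝓘(ℝ, E) 𝓘(ℝ, F) ∞ (fun x => ∫ z in K, ρ (x⁻¹ * z) • v z ∂μ) 1 := by
  set c := extChartAt 𝓘(ℝ, E) (1 : G)
  have hto : IsOpen c.target := isOpen_extChartAt_target 1
  have hcs : ContMDiffOn 𝓘(ℝ, E) 𝓘(ℝ, E) ∞ c.symm c.target := contMDiffOn_extChartAt_symm 1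
  have hL : ContDiffOn ℝ ∞ (fun p : E × (E × F) => ρ ((c.symm p.1)⁻¹ * c.symm p.2.1) • p.2.2)
      (c.target ×ˢ (c.target ×ˢ Set.univ)) := by
    refine ContDiffOn.smul ?_ contDiffOn_snd.snd
    rw [← contMDiffOn_iff_contDiffOn]
    refine hρ.comp_contMDiffOn (ContMDiffOn.mul (I := 𝓘(ℝ, E)) (ContMDiffOn.inv ?_) ?_)
    · exact hcs.comp contDiffOn_fst.contMDiffOn fun p hp => hp.1
    · exact hcs.comp contDiffOn_snd.fst.contMDiffOn fun p hp => hp.2.1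
  have hcK : ContinuousOn (fun z => (c z, v z)) K :=
    ((continuousOn_extChartAt (1 : G)).mono hKs).prodMk hv
  have hcK' : Set.MapsTo (fun z => (c z, v z)) K (c.target ×ˢ Set.univ) :=
    fun z hz => ⟨c.map_source (hKs hz), trivial⟩
  have h1 := contDiffOn_setIntegral (μ := μ) hto (hto.prod isOpen_univ) hK hcK hcK' hL
  have h2 : ContMDiffAt 𝓘(ℝ, E) 𝓘(ℝ, F) ∞ (fun x : G => ∫ z in K,
      ρ ((c.symm (c x))⁻¹ * c.symm (c z)) • v z ∂μ) 1 :=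
    ContMDiffAt.comp (g := fun x : E => ∫ z in K, ρ ((c.symm x)⁻¹ * c.symm (c z)) • v z ∂μ)
      (1 : G) (h1.contDiffAt (hto.mem_nhds (mem_extChartAt_target (I := 𝓘(ℝ, E)) (1 : G)))).contMDiffAt
      contMDiffAt_extChartAt
  refine h2.congr_of_eventuallyEq ?_
  filter_upwards [extChartAt_source_mem_nhds (I := 𝓘(ℝ, E)) (1 : G)] with x hx
  refine setIntegral_congr_fun hK.measurableSet fun z hz => ?_
  simp only [c.left_inv hx, c.left_inv (hKs hz)]

end LocalHom

section Smoothness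

open MeasureTheory

variable {E : Type*} [NormedAddCommGroup E] [NormedSpace ℝ E] [FiniteDimensional ℝ E]
  {G : Type*} [TopologicalSpace G] [T2Space G] [ChartedSpace E G] [Group G]
  [LieGroup 𝓘(ℝ, E) ∞ G]
  {E' : Type*} [NormedAddCommGroup E'] [NormedSpace ℝ E'] [FiniteDimensional ℝ E']
  {G' : Type*} [TopologicalSpace G'] [ChartedSpace E' G'] [Group G'] [LieGroup 𝓘(ℝ, E') ∞ G']

/-- A continuous local homomorphism `f` of Lie groups is smooth at the identity. In a chart of `G'`,
the average `∫ ρ (x⁻¹ * z) • f z` is smooth in `x`; invariance of Haar measure turns it into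
`∫ ρ y • (f x * f y)`, which is a local diffeomorphism applied to `f x`. -/
theorem contMDiffAt_one_of_continuousOn_of_map_mul {f : G → G'} {V : Set G} (hV : V ∈ 𝓝 1)
    (hf : ContinuousOn f V) (hmul : ∀ x ∈ V, ∀ y ∈ V, f (x * y) = f x * f y) :
    ContMDiffAt 𝓘(ℝ, E) 𝓘(ℝ, E') ∞ f 1 := by
  have : IsTopologicalGroup G := topologicalGroup_of_lieGroup 𝓘(ℝ, E) ∞
  have : LocallyCompactSpace G := ChartedSpace.locallyCompactSpace E G
  have : IsManifold 𝓘(ℝ, E) ∞ G := inferInstance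
  let _ : MeasurableSpace G := borel G
  have : BorelSpace G := ⟨rfl⟩
  let μ : Measure G := Measure.haar
  have hf1 : f 1 = 1 := by
    have := hmul 1 (mem_of_mem_nhds hV) 1 (mem_of_mem_nhds hV)
    simpa using this
  have hfc : ContinuousAt f 1 := hf.continuousAt hV
  set c := extChartAt 𝓘(ℝ, E') (1 : G') with hc
  obtain ⟨U, hU, haU, hUt, hm⟩ := exists_contDiffOn_chartMul (E := E') (G := G')
  have hUU : IsOpen (U ×ˢ U) := hU.prod hU
  have hcc : ContinuousAt c (f 1) := by
    rw [hf1]; exact continuousAt_extChartAt (I := 𝓘(ℝ, E')) (1 : G')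
  have hvc : ContinuousAt (fun y => c (f y)) 1 := hcc.comp hfc
  have hAc : ContinuousAt (fun w => ‖(fderiv ℝ (chartMul E' G') (c 1, w)).comp
      (ContinuousLinearMap.inl ℝ E' E') - ContinuousLinearMap.id ℝ E'‖) (c (f 1)) := by
    rw [hf1]
    refine ContinuousAt.norm (ContinuousAt.sub ?_ continuousAt_const)
    refine ContinuousAt.clm_comp ?_ continuousAt_const
    exact ContinuousAt.comp (f := fun w => (c 1, w)) (g := fderiv ℝ (chartMul E' G'))
      ((hm.continuousOn_fderiv_of_isOpen hUU (by simp)).continuousAt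
        (hUU.mem_nhds ⟨haU, haU⟩)) (by fun_prop)
  have hA0 : (fderiv ℝ (chartMul E' G') (c 1, c 1)).comp (ContinuousLinearMap.inl ℝ E' E') =
      ContinuousLinearMap.id ℝ E' := by
    have h1 : HasFDerivAt (chartMul E' G') (fderiv ℝ (chartMul E' G') (c 1, c 1)) (c 1, c 1) :=
      ((hm.contDiffAt (hUU.mem_nhds ⟨haU, haU⟩)).differentiableAt (by simp)).hasFDerivAt
    have h2 := HasFDerivAt.comp (f := fun u : E' => (u, c 1)) (c 1) h1
      (hasFDerivAt_prodMk_left (c 1) (c 1))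
    refine h2.unique ((hasFDerivAt_id (c 1)).congr_of_eventuallyEq ?_)
    filter_upwards [hU.mem_nhds haU] with u hu
    exact chartMul_one_right (hUt hu)
  have hN : ∀ᶠ y in 𝓝 (1 : G), (y ∈ V ∧ y ∈ (extChartAt 𝓘(ℝ, E) (1 : G)).source) ∧
      (f y ∈ c.source ∧ c (f y) ∈ U) ∧
      ‖(fderiv ℝ (chartMul E' G') (c 1, c (f y))).comp (ContinuousLinearMap.inl ℝ E' E') -
        ContinuousLinearMap.id ℝ E'‖ < 1 / 2 := by
    refine (Filter.Eventually.and hV (extChartAt_source_mem_nhds _)).and (.and (.and ?_ ?_) ?_)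
    · refine hfc.eventually_mem ?_
      rw [hf1]
      exact extChartAt_source_mem_nhds _
    · refine hvc.eventually_mem (hU.mem_nhds ?_)
      rwa [hf1]
    · refine Filter.Tendsto.eventually_lt_const (v := 0) (by norm_num) ?_
      have := hAc.tendsto.comp hvc.tendsto
      rw [hf1, hA0, sub_self, norm_zero] at this
      exact this
  obtain ⟨K, hK1, hKN, hK⟩ := local_compact_nhds hN
  obtain ⟨P, hPo, hP1, hPK⟩ := exists_open_nhds_one_mul_subset hK1
  have hPK' : P ⊆ K := fun x hx => by simpa using hPK (Set.mul_mem_mul hx hP1)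
  obtain ⟨ρ, -, hρP⟩ := (SmoothBumpFunction.nhds_basis_tsupport (I := 𝓘(ℝ, E))
    (1 : G)).mem_iff.1 (hPo.mem_nhds hP1)
  have hρ0 : ∀ y, y ∉ P → ρ y = 0 := fun y hy =>
    image_eq_zero_of_notMem_tsupport fun h => hy (hρP h)
  have hρK : ∀ y, y ∉ K → ρ y = 0 := fun y hy => hρ0 y fun h => hy (hPK' h)
  have hρI : 0 < ∫ y in K, ρ y ∂μ := by
    rw [setIntegral_eq_integral_of_forall_compl_eq_zero hρK]
    refine ρ.continuous.integral_pos_of_hasCompactSupport_nonneg_nonzero ρ.hasCompactSupport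
      (fun y => ρ.nonneg) (x := 1) ?_
    rw [ρ.eq_one]
    exact one_ne_zero
  have hvK : ContinuousOn (fun y => c (f y)) K :=
    (continuousOn_extChartAt (I := 𝓘(ℝ, E')) (1 : G')).comp (hf.mono fun y hy => (hKN hy).1.1)
      fun y hy => (hKN hy).2.1.1
  obtain ⟨g, hg, hgM⟩ := exists_contDiffAt_leftInverse_setIntegral (μ := μ) hK
    ρ.continuous.continuousOn (fun y => ρ.nonneg) hρI hU haU hvK (fun y hy => (hKN hy).2.1.2) hm
    fun y hy => (hKN hy).2.2.le
  have hΦ := contMDiffAt_setIntegral_translate (μ := μ) hK (fun y hy => (hKN hy).1.2)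
    ρ.contMDiff hvK
  -- both sides are the integral of `ρ y • c (f (x * y))` over `G`
  have key : ∀ x ∈ P, ∫ z in K, ρ (x⁻¹ * z) • c (f z) ∂μ =
      ∫ y in K, ρ y • chartMul E' G' (c (f x), c (f y)) ∂μ := by
    intro x hx
    rw [setIntegral_eq_integral_of_forall_compl_eq_zero,
      setIntegral_eq_integral_of_forall_compl_eq_zero,
      ← integral_mul_left_eq_self (μ := μ) _ x]
    · refine integral_congr_ae (.of_forall fun y => ?_)
      simp only [inv_mul_cancel_left]
      by_cases hy : y ∈ P
      · obtain ⟨⟨hxV, -⟩, ⟨hxs, -⟩, -⟩ := hKN (hPK' hx)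
        obtain ⟨⟨hyV, -⟩, ⟨hys, -⟩, -⟩ := hKN (hPK' hy)
        rw [chartMul, ← hc, c.left_inv hxs, c.left_inv hys, hmul x hxV y hyV]
      · rw [hρ0 y hy, zero_smul, zero_smul]
    · intro y hy
      rw [hρK y hy, zero_smul]
    · intro z hz
      rw [hρ0 _ fun h => hz ?_, zero_smul]
      simpa using hPK (Set.mul_mem_mul hx h)
  have hv : ContMDiffAt 𝓘(ℝ, E) 𝓘(ℝ, E') ∞ (fun x => c (f x)) 1 := by
    have hg' : ContMDiffAt 𝓘(ℝ, E') 𝓘(ℝ, E') ∞ g (∫ z in K, ρ ((1 : G)⁻¹ * z) • c (f z) ∂μ) := by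
      rw [key 1 hP1, hf1]
      exact hg.contMDiffAt
    refine (ContMDiffAt.comp (g := g) (1 : G) hg' hΦ).congr_of_eventuallyEq ?_
    rw [← hc, ← hf1] at hgM
    filter_upwards [hvc.tendsto.eventually hgM, hPo.mem_nhds hP1] with x hx hxP
    rw [Function.comp_apply, key x hxP, hx]
  have hcs : ContMDiffAt 𝓘(ℝ, E') 𝓘(ℝ, E') ∞ c.symm (c (f 1)) := by
    rw [hf1]
    exact (contMDiffOn_extChartAt_symm (1 : G')).contMDiffAt (extChartAt_target_mem_nhds 1)
  refine (ContMDiffAt.comp (g := c.symm) (1 : G) hcs hv).congr_of_eventuallyEq ?_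
  filter_upwards [hN] with x hx
  exact (c.left_inv hx.2.1.1).symm

/-- A continuous lift of a map between coset spaces is smooth, since up to translations it is a
local homomorphism. -/
theorem IsCosetLiftOn.contMDiffAt [T2Space G'] {Γ : Subgroup G} {Γ' : Subgroup G'} [Countable Γ']
    (hΓ : Dense (Γ : Set G)) {φ : G ⧸ Γ → G' ⧸ Γ'} {F : G → G'} {W : Set G}
    (hF : IsCosetLiftOn φ F W) (cF : ContinuousOn F W) {g : G} (hW : W ∈ 𝓝 g) :
    ContMDiffAt 𝓘(ℝ, E) 𝓘(ℝ, E') ∞ F g := by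
  have : IsTopologicalGroup G := topologicalGroup_of_lieGroup 𝓘(ℝ, E) ∞
  have : IsTopologicalGroup G' := topologicalGroup_of_lieGroup 𝓘(ℝ, E') ∞
  have : LocallyConnectedSpace G := ChartedSpace.locallyConnectedSpace E G
  have h1 : (fun p : G × G => g * p.1 * p.2) ⁻¹' W ∈ 𝓝 ((1 : G), (1 : G)) := by
    refine ContinuousAt.preimage_mem_nhds (by fun_prop) ?_
    simpa using hW
  obtain ⟨U₁, hU₁, U₂, hU₂, hU⟩ := mem_nhds_prod_iff.1 h1
  obtain ⟨V, ⟨hVo, h1V, hVc⟩, hV⟩ := (LocallyConnectedSpace.open_connected_basis (1 : G)).mem_iff.1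
    (Filter.inter_mem hU₁ hU₂)
  have hVW : ∀ x ∈ V, ∀ y ∈ V, g * x * y ∈ W := fun x hx y hy =>
    hU (Set.mk_mem_prod (hV hx).1 (hV hy).2)
  have hloc : ContMDiffAt 𝓘(ℝ, E) 𝓘(ℝ, E') ∞ (fun x => (F g)⁻¹ * F (g * x)) 1 := by
    refine contMDiffAt_one_of_continuousOn_of_map_mul (hVo.mem_nhds h1V) ?_ ?_
    · exact continuousOn_const.mul (cF.comp (by fun_prop) fun x hx => by
        simpa using hVW x hx 1 h1V)
    · intro x hx y hy
      rw [← mul_assoc g x y, hF.map_mul_mul hΓ hVc.isPreconnected hVo h1V cF hVW hx hy]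
      group
  have hloc' : ContMDiffAt 𝓘(ℝ, E) 𝓘(ℝ, E') ∞ (fun x => (F g)⁻¹ * F (g * x)) (g⁻¹ * g) := by
    rwa [inv_mul_cancel]
  have h2 := (contMDiff_mul_left (I := 𝓘(ℝ, E')) (n := ∞) (a := F g)).contMDiffAt.comp g
    (ContMDiffAt.comp g hloc' (contMDiff_mul_left (I := 𝓘(ℝ, E)) (n := ∞) (a := g⁻¹)).contMDiffAt)
  refine h2.congr_of_eventuallyEq (.of_forall fun x => ?_)
  simp

end Smoothness

/-! ### Plots of quotients and local lifts -/

namespace CrDiffeology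

/-- The pullback of a diffeology by a map `f : X → Y`: its plots are the parametrizations `α` for
which `f ∘ α` is a plot. -/
def pullback {r : ℕ∞} {X Y : Type*} (f : X → Y) (D : CrDiffeology r Y) : CrDiffeology r X where
  plots := {p | p.map f ∈ D.plots}
  const_mem U x := D.const_mem U (f x)
  locality p hp := D.locality (p.map f) hp
  reparam_mem p hp _ V h hV hh := D.reparam_mem (p.map f) hp V h hV hh

theorem map_mem_directImage {r : ℕ∞} {X Y : Type*} {f : X → Y} {D : CrDiffeology r X}
    {p : Parametrization X} (hp : p ∈ D.plots) : p.map f ∈ (directImage f D).plots :=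
  fun _ hD' => hD' (Set.mem_image_of_mem _ hp)

/-- The parametrizations of `G ⧸ Γ` that locally lift to continuous maps to `G`. They form a
`C^r`-diffeology for every `r`, because `C^r` maps are continuous. -/
def continuousLift (r : ℕ∞) {G : Type*} [TopologicalSpace G] [Group G] (Γ : Subgroup G) :
    CrDiffeology r (G ⧸ Γ) where
  plots := {p | ∀ u ∈ p.domain, ∃ V ∈ 𝓝 u, ∃ f : EuclideanSpace ℝ (Fin p.dim) → G,
    ContinuousOn f V ∧ ∀ v (hv : v ∈ p.domain), v ∈ V → (f v : G ⧸ Γ) = p.toFun ⟨v, hv⟩}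
  const_mem U x u _ := by
    obtain ⟨g, rfl⟩ := QuotientGroup.mk_surjective x
    exact ⟨Set.univ, Filter.univ_mem, fun _ => g, continuousOn_const, fun _ _ _ => rfl⟩
  locality p hp u hu := by
    obtain ⟨V, hV, huV, h⟩ := hp u hu
    obtain ⟨S, hS, f, hf, hfp⟩ := h u huV
    exact ⟨S ∩ V, Filter.inter_mem hS (V.isOpen.mem_nhds huV), f, hf.mono Set.inter_subset_left,
      fun v hv hvS => hfp v hvS.2 hvS.1⟩
  reparam_mem p hp m V h hV hh u hu := by
    obtain ⟨S, hS, f, hf, hfp⟩ := hp (h u) (hV u hu)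
    have hcont : ContinuousOn h V := hh.continuousOn
    refine ⟨h ⁻¹' S ∩ (V : Set (EuclideanSpace ℝ (Fin m))), Filter.inter_mem
      ((hcont.continuousAt (V.isOpen.mem_nhds hu)).preimage_mem_nhds hS) (V.isOpen.mem_nhds hu),
      f ∘ h, hf.comp (hcont.mono Set.inter_subset_right) fun v hv => hv.1, fun v hv hvS => ?_⟩
    exact hfp (h v) (hV v hv) hvS.1

variable {E : Type*} [NormedAddCommGroup E] [NormedSpace ℝ E]
  {G : Type*} [TopologicalSpace G] [ChartedSpace E G] [Group G]
  {E' : Type*} [NormedAddCommGroup E'] [NormedSpace ℝ E']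
  {G' : Type*} [TopologicalSpace G'] [ChartedSpace E' G'] [Group G']

theorem toClass_zero_quotient_subset_continuousLift (Γ : Subgroup G) :
    ((quotient 𝓘(ℝ, E) Γ).toClass 0).plots ⊆ (continuousLift 0 Γ).plots := by
  classical
  intro p hp
  refine hp _ fun q hq => hq (continuousLift ⊤ Γ) ?_
  rintro _ ⟨α, hα, rfl⟩ (u : EuclideanSpace ℝ (Fin α.dim)) (hu : u ∈ α.domain)
  have hα' : Continuous α.toFun := ContMDiff.continuous hα
  have hdif : ∀ v (hv : v ∈ α.domain),
      (if h : v ∈ α.domain then α.toFun ⟨v, h⟩ else 1) = α.toFun ⟨v, hv⟩ := fun v hv => dif_pos hv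
  refine ⟨(α.domain : Set (EuclideanSpace ℝ (Fin α.dim))), α.domain.isOpen.mem_nhds hu,
    fun v : EuclideanSpace ℝ (Fin α.dim) => if h : v ∈ α.domain then α.toFun ⟨v, h⟩ else 1, ?_,
    fun v hv _ => congrArg _ (hdif v hv)⟩
  exact continuousOn_iff_continuous_domRestrict.2 (hα'.congr fun v => (hdif v.1 v.2).symm)

/-- A map of class `C^0` between quotients has local continuous lifts: apply it to the projection
of a chart. -/
theorem IsDiffeologicalMap.exists_isCosetLiftOn [FiniteDimensional ℝ E] [LieGroup 𝓘(ℝ, E) ∞ G]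
    {Γ : Subgroup G} {Γ' : Subgroup G'} {φ : G ⧸ Γ → G' ⧸ Γ'}
    (hφ : IsDiffeologicalMap ((quotient 𝓘(ℝ, E) Γ).toClass 0)
      ((quotient 𝓘(ℝ, E') Γ').toClass 0) φ) (g : G) :
    ∃ W, IsOpen W ∧ g ∈ W ∧ ∃ F, ContinuousOn F W ∧ IsCosetLiftOn φ F W := by
  have : IsManifold 𝓘(ℝ, E) ∞ G := inferInstance
  set c := extChartAt 𝓘(ℝ, E) g with hc
  let e : E ≃L[ℝ] EuclideanSpace ℝ (Fin (Module.finrank ℝ E)) := toEuclidean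
  let α : Parametrization G := ⟨Module.finrank ℝ E,
    ⟨e.symm ⁻¹' c.target, (isOpen_extChartAt_target g).preimage e.symm.continuous⟩,
    fun v => c.symm (e.symm v.1)⟩
  have hα : α ∈ (manifold ⊤ 𝓘(ℝ, E) G).plots := by
    change ContMDiff _ _ ((⊤ : ℕ∞) : ℕ∞ω) _
    refine (contMDiffOn_extChartAt_symm (I := 𝓘(ℝ, E)) (n := ∞) g).comp_contMDiff
      (f := fun v : α.domain => e.symm v.1) ?_ fun v => v.2
    exact e.symm.contDiff.contMDiff.comp contMDiff_subtype_val
  have h1 : (α.map QuotientGroup.mk).map φ ∈ (continuousLift 0 Γ').plots :=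
    toClass_zero_quotient_subset_continuousLift (E := E') Γ'
      (hφ _ fun _ hD => hD (map_mem_directImage hα))
  have hmem : ∀ x ∈ c.source, e (c x) ∈ α.domain := fun x hx => by
    change e.symm (e (c x)) ∈ c.target
    rw [e.symm_apply_apply]
    exact c.map_source hx
  obtain ⟨V, hV, f, hf, hfα⟩ := h1 (e (c g)) (hmem g (mem_extChartAt_source g))
  have hcc : ContinuousOn (fun x => e (c x)) c.source :=
    e.continuous.comp_continuousOn (continuousOn_extChartAt g)
  refine ⟨c.source ∩ (fun x => e (c x)) ⁻¹' interior V,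
    hcc.isOpen_inter_preimage (isOpen_extChartAt_source g) isOpen_interior,
    ⟨mem_extChartAt_source g, mem_interior_iff_mem_nhds.2 hV⟩, fun x => f (e (c x)),
    hf.comp (hcc.mono Set.inter_subset_left) fun x hx => interior_subset hx.2, fun x hx => ?_⟩
  dsimp only
  rw [hfα _ (hmem x hx.1) (interior_subset hx.2)]
  change φ ((c.symm (e.symm (e (c x))) : G) : G ⧸ Γ) = φ x
  rw [e.symm_apply_apply, c.left_inv hx.1]

/-- A map between quotients with local smooth lifts is of class `C^∞`. -/
theorem isDiffeologicalMap_quotient {Γ : Subgroup G} {Γ' : Subgroup G'} {φ : G ⧸ Γ → G' ⧸ Γ'}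
    (h : ∀ g, ∃ W, IsOpen W ∧ g ∈ W ∧ ∃ F : G → G',
      ContMDiffOn 𝓘(ℝ, E) 𝓘(ℝ, E') ∞ F W ∧ IsCosetLiftOn φ F W) :
    IsDiffeologicalMap (quotient 𝓘(ℝ, E) Γ) (quotient 𝓘(ℝ, E') Γ') φ := by
  intro p hp
  refine hp (pullback φ (quotient 𝓘(ℝ, E') Γ')) ?_
  rintro _ ⟨α, hα, rfl⟩
  refine (quotient 𝓘(ℝ, E') Γ').locality _ fun u hu => ?_
  obtain ⟨W, hWo, hW, F, hF, hFφ⟩ := h (α.toFun ⟨u, hu⟩)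
  have hα' : ContMDiff (𝓡 α.dim) 𝓘(ℝ, E) ∞ α.toFun := hα
  let V : TopologicalSpace.Opens (EuclideanSpace ℝ (Fin α.dim)) :=
    ⟨Subtype.val '' (α.toFun ⁻¹' W),
      α.domain.isOpen.isOpenMap_subtype_val _ (hWo.preimage hα'.continuous)⟩
  have hV : V ≤ α.domain := by rintro _ ⟨v, -, rfl⟩; exact v.2
  have hVW : ∀ v (hv : v ∈ V), α.toFun ⟨v, hV hv⟩ ∈ W := by rintro _ ⟨v, hv, rfl⟩; exact hv
  let β : Parametrization G' := ⟨α.dim, V, fun v => F (α.toFun ⟨v.1, hV v.2⟩)⟩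
  have hβ : β ∈ (manifold ⊤ 𝓘(ℝ, E') G').plots := by
    change ContMDiff _ _ ((⊤ : ℕ∞) : ℕ∞ω) _
    exact hF.comp_contMDiff (hα'.comp (contMDiff_inclusion hV)) fun v => hVW v.1 v.2
  refine ⟨V, hV, ⟨⟨u, hu⟩, hW, rfl⟩, ?_⟩
  convert! map_mem_directImage (f := (QuotientGroup.mk : G' → G' ⧸ Γ')) hβ using 1
  simp only [Parametrization.restrict, Parametrization.map, β]
  congr 1
  funext v
  exact (hFφ _ (hVW v.1 v.2)).symm

end CrDiffeology

/-! ### Isomorphisms of quotients -/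

section Main

variable {E : Type*} [NormedAddCommGroup E] [NormedSpace ℝ E] [FiniteDimensional ℝ E]
  {G : Type*} [TopologicalSpace G] [T2Space G] [ChartedSpace E G] [Group G]
  [LieGroup 𝓘(ℝ, E) ∞ G]
  {E' : Type*} [NormedAddCommGroup E'] [NormedSpace ℝ E'] [FiniteDimensional ℝ E']
  {G' : Type*} [TopologicalSpace G'] [T2Space G'] [ChartedSpace E' G'] [Group G']
  [LieGroup 𝓘(ℝ, E') ∞ G'] {Γ : Subgroup G} {Γ' : Subgroup G'}

/-- A map of class `C^0` between strongly homogeneous spaces is of class `C^∞`. -/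
theorem CrDiffeology.IsDiffeologicalMap.smooth [Countable Γ'] (hΓ : Dense (Γ : Set G))
    {φ : G ⧸ Γ → G' ⧸ Γ'}
    (hφ : IsDiffeologicalMap ((quotient 𝓘(ℝ, E) Γ).toClass 0)
      ((quotient 𝓘(ℝ, E') Γ').toClass 0) φ) :
    IsDiffeologicalMap (quotient 𝓘(ℝ, E) Γ) (quotient 𝓘(ℝ, E') Γ') φ := by
  refine isDiffeologicalMap_quotient fun g => ?_
  obtain ⟨W, hWo, hW, F, cF, hF⟩ := hφ.exists_isCosetLiftOn g
  exact ⟨W, hWo, hW, F, fun x hx =>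
    (hF.contMDiffAt hΓ cF (hWo.mem_nhds hx)).contMDiffWithinAt, hF⟩

/-- On a simply connected group, a map of class `C^0` between quotients is covered by a smooth
homomorphism followed by a left translation. -/
theorem CrDiffeology.IsDiffeologicalMap.exists_monoidHom [SimplyConnectedSpace G] [Countable Γ']
    (hΓ : Dense (Γ : Set G)) {φ : G ⧸ Γ → G' ⧸ Γ'}
    (hφ : IsDiffeologicalMap ((quotient 𝓘(ℝ, E) Γ).toClass 0)
      ((quotient 𝓘(ℝ, E') Γ').toClass 0) φ) :
    ∃ (a : G') (Ψ : G →* G'), ContMDiff 𝓘(ℝ, E) 𝓘(ℝ, E') ∞ Ψ ∧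
      ∀ g, ((a * Ψ g : G') : G' ⧸ Γ') = φ g := by
  have : IsTopologicalGroup G := topologicalGroup_of_lieGroup 𝓘(ℝ, E) ∞
  have : IsTopologicalGroup G' := topologicalGroup_of_lieGroup 𝓘(ℝ, E') ∞
  have : LocallyPathConnectedSpace G := ChartedSpace.locallyPathConnectedSpace E G
  obtain ⟨F, cF, hF⟩ := IsCosetLiftOn.exists_global hφ.exists_isCosetLiftOn
  have hsm : ContMDiff 𝓘(ℝ, E) 𝓘(ℝ, E') ∞ F := fun g =>
    hF.contMDiffAt hΓ cF.continuousOn Filter.univ_mem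
  refine ⟨F 1, MonoidHom.mk' (fun g => (F 1)⁻¹ * F g) fun x y => ?_, ?_, fun g => ?_⟩
  · have := hF.map_mul_mul hΓ isPreconnected_univ isOpen_univ (Set.mem_univ 1) (g := 1)
      cF.continuousOn (fun _ _ _ _ => Set.mem_univ _) (Set.mem_univ x) (Set.mem_univ y)
    rw [one_mul, one_mul] at this
    rw [this]
    group
  · exact (contMDiff_mul_left (I := 𝓘(ℝ, E')) (n := ∞) (a := (F 1)⁻¹)).comp hsm
  · simpa using hF g (Set.mem_univ g)

/-- A continuous endomorphism covering, up to a translation, the identity of `G ⧸ Γ` is an inner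
automorphism. -/
theorem exists_eq_conj_of_mk_eq {G : Type*} [Group G] [TopologicalSpace G] [IsTopologicalGroup G]
    [T2Space G] [ConnectedSpace G] {Γ : Subgroup G} [Countable Γ] {Ψ : G →* G}
    (hΨ : Continuous Ψ) {a : G} (h : ∀ g, ((a * Ψ g : G) : G ⧸ Γ) = g) : ∃ γ : G, ∀ g, Ψ g = γ⁻¹ * g * γ := by
  refine ⟨a, fun g => ?_⟩
  have := IsCosetLiftOn.inv_mul_eq (φ := id) (F₁ := fun g : G => g) (F₂ := fun g => a * Ψ g)
    (Γ := Γ) (Γ' := Γ) isPreconnected_univ (fun _ _ => rfl) (fun g _ => h g) continuousOn_id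
    (continuous_const.mul hΨ).continuousOn (Set.mem_univ g) (Set.mem_univ 1)
  simp only [map_one, inv_one, one_mul, mul_one] at this
  rw [inv_mul_eq_iff_eq_mul] at this
  rw [mul_assoc, ← this, inv_mul_cancel_left]

end Main

theorem mainTheorem3
    {E : Type*} [NormedAddCommGroup E] [NormedSpace ℝ E] [FiniteDimensional ℝ E]
    {G : Type*} [TopologicalSpace G] [T2Space G] [ChartedSpace E G] [Group G]
    [LieGroup 𝓘(ℝ, E) ∞ G] [ConnectedSpace G]
    {E' : Type*} [NormedAddCommGroup E'] [NormedSpace ℝ E'] [FiniteDimensional ℝ E']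
    {G' : Type*} [TopologicalSpace G'] [T2Space G'] [ChartedSpace E' G'] [Group G']
    [LieGroup 𝓘(ℝ, E') ∞ G'] [ConnectedSpace G']
    (Γ : Subgroup G) (hΓ_countable : Countable Γ) (hΓ_dense : Dense (Γ : Set G))
    (Γ' : Subgroup G') (hΓ'_countable : Countable Γ') (hΓ'_dense : Dense (Γ' : Set G'))
    (φ : G ⧸ Γ ≃ G' ⧸ Γ')
    (hφ : CrDiffeology.IsDiffeologicalIso
      ((CrDiffeology.quotient 𝓘(ℝ, E) Γ).toClass 0)
      ((CrDiffeology.quotient 𝓘(ℝ, E') Γ').toClass 0) φ) :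
    CrDiffeology.IsDiffeologicalIso
      (CrDiffeology.quotient 𝓘(ℝ, E) Γ) (CrDiffeology.quotient 𝓘(ℝ, E') Γ') φ ∧
    (SimplyConnectedSpace G → SimplyConnectedSpace G' →
      ∃ Ψ : G ≃* G', ContMDiff 𝓘(ℝ, E) 𝓘(ℝ, E') ∞ Ψ ∧
        ContMDiff 𝓘(ℝ, E') 𝓘(ℝ, E) ∞ Ψ.symm) := by
  refine ⟨⟨hφ.1.smooth hΓ_dense, hφ.2.smooth hΓ'_dense⟩, fun _ _ => ?_⟩
  have : IsTopologicalGroup G := topologicalGroup_of_lieGroup 𝓘(ℝ, E) ∞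
  have : IsTopologicalGroup G' := topologicalGroup_of_lieGroup 𝓘(ℝ, E') ∞
  obtain ⟨a, Ψ, hΨ, hΨφ⟩ := hφ.1.exists_monoidHom hΓ_dense
  obtain ⟨b, Θ, hΘ, hΘφ⟩ := hφ.2.exists_monoidHom hΓ'_dense
  have h1 : ∀ g, ((b * Θ a * (Θ.comp Ψ) g : G) : G ⧸ Γ) = g := fun g => by
    have := hΘφ (a * Ψ g)
    rw [hΨφ, φ.symm_apply_apply, map_mul, ← mul_assoc] at this
    exact this
  have h2 : ∀ g, ((a * Ψ b * (Ψ.comp Θ) g : G') : G' ⧸ Γ') = g := fun g => by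
    have := hΨφ (b * Θ g)
    rw [hΘφ, φ.apply_symm_apply, map_mul, ← mul_assoc] at this
    exact this
  obtain ⟨γ, hγ⟩ := exists_eq_conj_of_mk_eq (hΘ.continuous.comp hΨ.continuous) h1
  obtain ⟨δ, hδ⟩ := exists_eq_conj_of_mk_eq (hΨ.continuous.comp hΘ.continuous) h2
  have hΘΨ : ∀ g, γ * Θ (Ψ g) * γ⁻¹ = g := fun g => by
    have : Θ (Ψ g) = γ⁻¹ * g * γ := hγ g
    rw [this]
    group
  have hinj : Function.Injective Ψ := fun x y h => by rw [← hΘΨ x, h, hΘΨ]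
  have hsurj : Function.Surjective Ψ := fun x => by
    have h : Ψ (Θ (δ * x * δ⁻¹)) = δ⁻¹ * (δ * x * δ⁻¹) * δ := hδ _
    exact ⟨_, h.trans (by group)⟩
  let e : G ≃* G' := MulEquiv.ofBijective Ψ ⟨hinj, hsurj⟩
  refine ⟨e, hΨ, ?_⟩
  -- the inverse of `Ψ` is `Θ` followed by an inner automorphism
  have he : ⇑e.symm = fun x => γ * Θ x * γ⁻¹ := by
    funext x
    obtain ⟨g, rfl⟩ := e.surjective x
    rw [e.symm_apply_apply]
    exact (hΘΨ g).symm
  rw [he]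
  exact ((contMDiff_const (I' := 𝓘(ℝ, E))).mul hΘ).mul contMDiff_const
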